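/- Let $\mathcal V$ be a complete and cocomplete symmetric monoidal closed category, and let $F\colon\mathcal A\to\mathcal B$ be a $\mathcal V$-functor between (not necessarily small) $\mathcal V$-categories. The following are equivalent: (a) $F$ is *Cauchy dense*: for all $b,b'\in\mathcal B$ the coend $\int^{a}\mathcal B(Fa,b')\otimes\mathcal B(b,Fa)$ exists in $\mathcal V$, and the morphism from it to $\mathcal B(b,b')$ induced by the composition of $\mathcal B$ is an isomorphism; (b) $F$ is *absolutely dense*: the identity transformation $F\Rightarrow 1_{\mathcal B}F$ exhibits $1_{\mathcal B}$ as the pointwise left Kan extension $\mathrm{Lan}_F F$, and this Kan extension is preserved by every $\mathcal V$-functor $H\colon\mathcal B\to\mathcal C$, i.e. the identity exhibits $H$ as the pointwise left Kan extension $\mathrm{Lan}_F(HF)$; (c) $F$ is *absolutely codense*: the identity transformation $1_{\mathcal B}F\Rightarrow F$ exhibits $1_{\mathcal B}$ as the pointwise right Kan extension $\mathrm{Ran}_F F$, and this Kan extension is preserved by every $\mathcal V$-functor $H\colon\mathcal B\to\mathcal C$, i.e. the identity exhibits $H$ as the pointwise right Kan extension $\mathrm{Ran}_F(HF)$. Here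 $\mathcal C$ ranges over all (not necessarily small) $\mathcal V$-categories. A transformation $\varepsilon\colon RF\Rightarrow G$ exhibits $R\colon\mathcal B\to\mathcal C$ as the pointwise right Kan extension of $G\colon\mathcal A\to\mathcal C$ along $F$ if for all $b\in\mathcal B$, $c\in\mathcal C$ the canonical $\mathcal V$-natural family $\mathcal C(c,Rb)\to[\mathcal B(b,Fa),\mathcal C(c,Ga)]$ $(a\in\mathcal A)$ is universal, i.e. exhibits $\mathcal C(c,Rb)$ as the (in particular existing) object of $\mathcal V$-natural transformations $\mathcal B(b,F-)\Rightarrow\mathcal C(c,G-)$; pointwise left Kan extensions are defined dually, with $\mathcal C(Lb,c)\to[\mathcal B(Fa,b),\mathcal C(Ga,c)]$. -/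

import Mathlib

universe w v u₁ u₂ u₃ t

set_option linter.unusedSectionVars false

noncomputable section

namespace EnrichedDensity

open CategoryTheory MonoidalCategory BraidedCategory Opposite
open scoped CategoryTheory.MonoidalClosed

/-! ### Enriched functors: opposites and representables -/

section Functors

variable {V : Type v} [Category.{w} V] [MonoidalCategory V]

/-- The opposite `Fᵒᵖ : Aᵒᵖ ⟶ Bᵒᵖ` of a `V`-functor. -/
@[simps]
def opFunctor [BraidedCategory V] {A : Type u₁} {B : Type u₂} [EnrichedCategory V A]
    [EnrichedCategory V B] (F : EnrichedFunctor V A B) : EnrichedFunctor V Aᵒᵖ Bᵒᵖ where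
  obj a := op (F.obj a.unop)
  map a a' := F.map a'.unop a.unop
  map_id a := F.map_id a.unop
  map_comp a a' a'' := by
    rw [tensorHom_eComp_op_eq, eComp_op_eq, Category.assoc, F.map_comp]
    rfl

lemma uncurry_tensorHom_comp [MonoidalClosed V] {x y z X Y : V}
    (f : X ⟶ (ihom x).obj y) (g : Y ⟶ (ihom y).obj z) :
    MonoidalClosed.uncurry ((f ⊗ₘ g) ≫ MonoidalClosed.comp x y z) =
      (α_ x X Y).inv ≫ MonoidalClosed.uncurry f ▷ Y ≫ MonoidalClosed.uncurry g := by
  rw [MonoidalClosed.uncurry_natural_left, MonoidalClosed.comp_eq, MonoidalClosed.uncurry_curry,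
    MonoidalClosed.compTranspose_eq, MonoidalClosed.uncurry_eq, MonoidalClosed.uncurry_eq,
    MonoidalCategory.tensorHom_def]
  simp only [MonoidalCategory.whiskerLeft_comp, Category.assoc, comp_whiskerRight]
  rw [associator_inv_naturality_right_assoc, associator_inv_naturality_middle_assoc,
    whisker_exchange_assoc]
  rfl

lemma uncurry_comp_curry [MonoidalClosed V] {x y X Y : V} (f : X ⟶ Y) (g : x ⊗ Y ⟶ y) :
    MonoidalClosed.uncurry (f ≫ MonoidalClosed.curry g) = x ◁ f ≫ g := by
  rw [MonoidalClosed.uncurry_natural_left, MonoidalClosed.uncurry_curry]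

variable [MonoidalClosed V]

/-- The covariant representable `V`-functor `C(c, -) : C ⟶ V`, where `V` is regarded as a
`V`-category through its internal hom.  The contravariant representable
`C(-, c) : Cᵒᵖ ⟶ V` is `homFunctor (op c)`. -/
@[simps]
def homFunctor {C : Type u₁} [EnrichedCategory V C] (c : C) : EnrichedFunctor V C V where
  obj d := c ⟶[V] d
  map d d' := MonoidalClosed.curry (eComp V c d d')
  map_id d := by
    apply MonoidalClosed.uncurry_injective
    rw [MonoidalClosed.uncurry_natural_left, MonoidalClosed.uncurry_curry,
      MonoidalClosed.enrichedCategorySelf_id, MonoidalClosed.id_eq, MonoidalClosed.uncurry_curry,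
      ← cancel_epi (ρ_ (c ⟶[V] d)).inv, e_comp_id, Iso.inv_hom_id]
  map_comp d d' d'' := by
    apply MonoidalClosed.uncurry_injective
    rw [MonoidalClosed.enrichedCategorySelf_comp, uncurry_tensorHom_comp,
      MonoidalClosed.uncurry_natural_left]
    simp only [MonoidalClosed.uncurry_curry]
    rw [e_assoc]

/-- The action `P a ⊗ A(a, a') ⟶ P a'` of a `V`-functor `P : A ⟶ V`. -/
def action {A : Type u₁} [EnrichedCategory V A] (P : EnrichedFunctor V A V) (a a' : A) :
    P.obj a ⊗ (a ⟶[V] a') ⟶ P.obj a' :=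
  MonoidalClosed.uncurry (P.map a a')

end Functors

/-! ### Coends and Cauchy density -/

section Coends

variable {V : Type v} [Category.{w} V] [MonoidalCategory V] [SymmetricCategory V]
  [MonoidalClosed V] {A : Type u₁} [EnrichedCategory V A] {B : Type u₂} [EnrichedCategory V B]

/-- A cowedge under `P(-) ⊗ Q(-)`: an object `X` of `V` with a family
`P a ⊗ Q a ⟶ X` which is extraordinarily `V`-natural in `a`, i.e. coequalizes the two actions
of `A(a, a')` on `P a' ⊗ Q a`. -/
structure Cowedge (P : EnrichedFunctor V Aᵒᵖ V) (Q : EnrichedFunctor V A V) where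
  /-- the vertex -/
  pt : V
  /-- the components -/
  ι (a : A) : P.obj (op a) ⊗ Q.obj a ⟶ pt
  condition (a a' : A) :
    P.obj (op a') ◁ action Q a a' ≫ ι a' =
      P.obj (op a') ◁ (β_ (Q.obj a) (a ⟶[V] a')).hom ≫
        (α_ (P.obj (op a')) (a ⟶[V] a') (Q.obj a)).inv ≫
          action P (op a') (op a) ▷ Q.obj a ≫ ι a

/-- The cowedge `c` is a coend `∫^a P a ⊗ Q a`: it is the universal cowedge. -/
def Cowedge.IsCoend {P : EnrichedFunctor V Aᵒᵖ V} {Q : EnrichedFunctor V A V}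
    (c : Cowedge P Q) : Prop :=
  ∀ d : Cowedge P Q, ∃! f : c.pt ⟶ d.pt, ∀ a, c.ι a ≫ f = d.ι a

/-- The functor `B(F-, b') : Aᵒᵖ ⟶ V`. -/
abbrev homTo (F : EnrichedFunctor V A B) (b' : B) : EnrichedFunctor V Aᵒᵖ V :=
  (opFunctor F).comp V (homFunctor (op b'))

/-- The functor `B(b, F-) : A ⟶ V`. -/
abbrev homFrom (F : EnrichedFunctor V A B) (b : B) : EnrichedFunctor V A V :=
  F.comp V (homFunctor b)

lemma action_homFrom (F : EnrichedFunctor V A B) (b : B) (a a' : A) :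
    action (homFrom F b) a a' =
      (b ⟶[V] F.obj a) ◁ F.map a a' ≫ eComp V b (F.obj a) (F.obj a') := by
  exact uncurry_comp_curry _ _

lemma action_homTo (F : EnrichedFunctor V A B) (b' : B) (a a' : A) :
    action (homTo F b') (op a') (op a) =
      (F.obj a' ⟶[V] b') ◁ F.map a a' ≫
        (β_ (F.obj a' ⟶[V] b') (F.obj a ⟶[V] F.obj a')).hom ≫
          eComp V (F.obj a) (F.obj a') b' := by
  exact uncurry_comp_curry _ _

lemma braiding_tensor_swap (W P Q : V) :
    W ◁ (β_ P Q).hom ≫ (α_ W Q P).inv ≫ (β_ W Q).hom ▷ P ≫ (β_ (Q ⊗ W) P).hom =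
      (β_ W (P ⊗ Q)).hom ≫ (α_ P Q W).hom := by
  have h : (α_ W Q P).inv ≫ (β_ W Q).hom ▷ P ≫ (α_ Q W P).hom ≫ Q ◁ (β_ W P).hom =
      (β_ W (Q ⊗ P)).hom ≫ (α_ Q P W).hom := by
    simp [braiding_tensor_right_hom]
  rw [braiding_tensor_left_hom, reassoc_of% h, Iso.hom_inv_id_assoc,
    braiding_naturality_right_assoc, ← comp_whiskerRight_assoc, SymmetricCategory.symmetry,
    id_whiskerRight, Category.id_comp]

lemma compCowedge_aux {X : V} {b b' x y : B} (f : X ⟶ (x ⟶[V] y)) :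
    (y ⟶[V] b') ◁ ((b ⟶[V] x) ◁ f ≫ eComp V b x y) ≫
        (β_ (y ⟶[V] b') (b ⟶[V] y)).hom ≫ eComp V b y b' =
      (y ⟶[V] b') ◁ (β_ (b ⟶[V] x) X).hom ≫ (α_ (y ⟶[V] b') X (b ⟶[V] x)).inv ≫
        ((y ⟶[V] b') ◁ f ≫ (β_ (y ⟶[V] b') (x ⟶[V] y)).hom ≫ eComp V x y b') ▷ (b ⟶[V] x) ≫
          (β_ (x ⟶[V] b') (b ⟶[V] x)).hom ≫ eComp V b x b' := by
  simp only [MonoidalCategory.whiskerLeft_comp, comp_whiskerRight, Category.assoc]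
  rw [braiding_naturality_right_assoc, ← e_assoc', braiding_naturality_left_assoc,
    ← associator_inv_naturality_middle_assoc, ← MonoidalCategory.whiskerLeft_comp_assoc,
    ← braiding_naturality_right, MonoidalCategory.whiskerLeft_comp_assoc]
  have := braiding_tensor_swap (y ⟶[V] b') (b ⟶[V] x) (x ⟶[V] y)
  rw [reassoc_of% this]

/-- The cowedge `B(Fa, b') ⊗ B(b, Fa) ⟶ B(b, b')` given by composition in `B`
(the symmetry appears because Mathlib writes composition in diagrammatic order). -/
@[simps]
def compCowedge (F : EnrichedFunctor V A B) (b b' : B) :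
    Cowedge (homTo F b') (homFrom F b) where
  pt := b ⟶[V] b'
  ι a := (β_ (F.obj a ⟶[V] b') (b ⟶[V] F.obj a)).hom ≫ eComp V b (F.obj a) b'
  condition a a' := by
    rw [action_homFrom, action_homTo]
    exact compCowedge_aux (F.map a a')

/-- `F` is Cauchy dense: for all `b, b'` the coend `∫^a B(Fa, b') ⊗ B(b, Fa)` exists and the
morphism from it to `B(b, b')` induced by composition is an isomorphism. -/
def CauchyDense (F : EnrichedFunctor V A B) : Prop :=
  ∀ b b' : B, ∃ c : Cowedge (homTo F b') (homFrom F b), c.IsCoend ∧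
    ∃ ε : c.pt ⟶ (b ⟶[V] b'), (∀ a, c.ι a ≫ ε = (compCowedge F b b').ι a) ∧ IsIso ε

end Coends

/-! ### `V`-natural transformations and objects of `V`-natural transformations -/

section Elements

variable {V : Type v} [Category.{w} V] [MonoidalCategory V] {C : Type u₃} [EnrichedCategory V C]

/-- Postcomposition `C(x, y) ⟶ C(x, z)` with `e`. -/
def postComp {y z : C} (e : 𝟙_ V ⟶ (y ⟶[V] z)) (x : C) : (x ⟶[V] y) ⟶ (x ⟶[V] z) :=
  (ρ_ (x ⟶[V] y)).inv ≫ (x ⟶[V] y) ◁ e ≫ eComp V x y z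

/-- Precomposition `C(z, x) ⟶ C(y, x)` with `e`. -/
def preComp {y z : C} (e : 𝟙_ V ⟶ (y ⟶[V] z)) (x : C) : (z ⟶[V] x) ⟶ (y ⟶[V] x) :=
  (λ_ (z ⟶[V] x)).inv ≫ e ▷ (z ⟶[V] x) ≫ eComp V y z x

lemma eComp_postComp (x' x : C) {y z : C} (e : 𝟙_ V ⟶ (y ⟶[V] z)) :
    eComp V x' x y ≫ postComp e x' =
      (x' ⟶[V] x) ◁ postComp e x ≫ eComp V x' x z := by
  simp only [postComp, MonoidalCategory.whiskerLeft_comp, Category.assoc]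
  rw [← e_assoc, rightUnitor_inv_naturality_assoc, ← whisker_exchange_assoc]
  simp

lemma eComp_preComp {y z : C} (e : 𝟙_ V ⟶ (y ⟶[V] z)) (x x' : C) :
    eComp V z x x' ≫ preComp e x' =
      preComp e x ▷ (x ⟶[V] x') ≫ eComp V y x x' := by
  simp only [preComp, comp_whiskerRight, Category.assoc]
  rw [← e_assoc', leftUnitor_inv_naturality_assoc, whisker_exchange_assoc]
  simp

lemma preComp_eComp (x : C) {y z : C} (e : 𝟙_ V ⟶ (y ⟶[V] z)) (x' : C) :
    (x ⟶[V] y) ◁ preComp e x' ≫ eComp V x y x' =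
      postComp e x ▷ (z ⟶[V] x') ≫ eComp V x z x' := by
  simp only [preComp, postComp, MonoidalCategory.whiskerLeft_comp, comp_whiskerRight,
    Category.assoc]
  rw [← e_assoc]
  simp

end Elements

section NatTrans

variable {V : Type v} [Category.{w} V] [MonoidalCategory V] [SymmetricCategory V]
  {A : Type u₁} [EnrichedCategory V A] {B : Type u₂} [EnrichedCategory V B]
  {C : Type u₃} [EnrichedCategory V C]

/-- `V`-natural families `X ⟶ B(Fa, Ga)`, for an object `X` of `V`: the generalized elements
of shape `X` of the (possibly non-existent) object of `V`-natural transformations `F ⟶ G`.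
This is `GradedNatTrans` for the half-braiding on `X` given by the symmetry of `V`. -/
@[ext]
structure VNatFamily (X : V) (F G : EnrichedFunctor V A B) where
  /-- the components -/
  app (a : A) : X ⟶ (F.obj a ⟶[V] G.obj a)
  naturality (a a' : A) :
    (β_ X (a ⟶[V] a')).hom ≫ (F.map a a' ⊗ₘ app a') ≫
        eComp V (F.obj a) (F.obj a') (G.obj a') =
      (app a ⊗ₘ G.map a a') ≫ eComp V (F.obj a) (G.obj a) (G.obj a')

/-- `V`-natural transformations: families `𝟙_ V ⟶ B(Fa, Ga)` satisfying the usual hexagon.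
(Mathlib's `EnrichedNatTrans` only asks for ordinary naturality on underlying categories, which
is weaker in general.) -/
abbrev VNatTrans (F G : EnrichedFunctor V A B) := VNatFamily (𝟙_ V) F G

/-- A `V`-natural family `θ : K ⟶ B(Fa, Ga)` exhibits `K` as the object `[A, B](F, G)` of
`V`-natural transformations, i.e. as the end `∫_a B(Fa, Ga)`. -/
def IsNatObject {K : V} {F G : EnrichedFunctor V A B} (θ : VNatFamily K F G) : Prop :=
  ∀ (X : V) (τ : VNatFamily X F G), ∃! f : X ⟶ K, ∀ a, f ≫ θ.app a = τ.app a

lemma id_aux {Y : V} {x y : B} {f f' : Y ⟶ (x ⟶[V] y)} (h : f = f') :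
    (β_ (𝟙_ V) Y).hom ≫ (f ⊗ₘ eId V y) ≫ eComp V x y y =
      (eId V x ⊗ₘ f') ≫ eComp V x x y := by
  subst h
  have h₁ := e_comp_id V x y
  have h₂ := e_id_comp V x y
  rw [Iso.inv_comp_eq, Category.comp_id] at h₁ h₂
  rw [MonoidalCategory.tensorHom_def, Category.assoc, h₁, tensorHom_def', Category.assoc, h₂,
    braiding_tensorUnit_left]
  simp

lemma whisker_aux {D : Type t} [EnrichedCategory V D] (H : EnrichedFunctor V C D) {X Y : V}
    {x y y' z : C} {f : Y ⟶ (x ⟶[V] y)} {g : X ⟶ (y ⟶[V] z)} {g' : X ⟶ (x ⟶[V] y')}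
    {f' : Y ⟶ (y' ⟶[V] z)} {m : Y ⟶ (H.obj x ⟶[V] H.obj y)}
    {m' : Y ⟶ (H.obj y' ⟶[V] H.obj z)}
    (e : (β_ X Y).hom ≫ (f ⊗ₘ g) ≫ eComp V x y z = (g' ⊗ₘ f') ≫ eComp V x y' z)
    (hm : m = f ≫ H.map x y) (hm' : m' = f' ≫ H.map y' z) :
    (β_ X Y).hom ≫ (m ⊗ₘ (g ≫ H.map y z)) ≫ eComp V (H.obj x) (H.obj y) (H.obj z) =
      ((g' ≫ H.map x y') ⊗ₘ m') ≫ eComp V (H.obj x) (H.obj y') (H.obj z) := by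
  subst hm hm'
  rw [← tensorHom_comp_tensorHom, ← tensorHom_comp_tensorHom, Category.assoc, Category.assoc,
    ← H.map_comp, ← H.map_comp, reassoc_of% e]

lemma VNatTrans.map_postComp {F G : EnrichedFunctor V A B} (θ : VNatTrans F G) (a a' : A) :
    F.map a a' ≫ postComp (θ.app a') (F.obj a) = G.map a a' ≫ preComp (θ.app a) (G.obj a') := by
  have h := θ.naturality a a'
  rw [braiding_tensorUnit_left, Category.assoc, ← cancel_epi (λ_ (a ⟶[V] a')).inv,
    Iso.inv_hom_id_assoc] at h
  simp only [postComp, preComp]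
  rw [rightUnitor_inv_naturality_assoc, leftUnitor_inv_naturality_assoc,
    ← MonoidalCategory.tensorHom_def_assoc, h, tensorHom_def'_assoc]

/-- The identity transformation, as a transformation `F ⟶ 1 F`. -/
@[simps]
def idToComp (F : EnrichedFunctor V A B) :
    VNatTrans F (F.comp V (EnrichedFunctor.id V B)) where
  app a := eId V (F.obj a)
  naturality a a' := by
    exact id_aux (Category.comp_id _).symm

/-- The identity transformation, as a transformation `1 F ⟶ F`. -/
@[simps]
def idFromComp (F : EnrichedFunctor V A B) :
    VNatTrans (F.comp V (EnrichedFunctor.id V B)) F where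
  app a := eId V (F.obj a)
  naturality a a' := by
    exact id_aux (Category.comp_id _)

/-- Whiskering of `η : G ⟶ L F` with `H`, giving `H G ⟶ (H L) F`. -/
@[simps]
def whiskerTo {D : Type t} [EnrichedCategory V D] {F : EnrichedFunctor V A B}
    {G : EnrichedFunctor V A C} {L : EnrichedFunctor V B C} (η : VNatTrans G (F.comp V L))
    (H : EnrichedFunctor V C D) : VNatTrans (G.comp V H) (F.comp V (L.comp V H)) where
  app a := η.app a ≫ H.map (G.obj a) (L.obj (F.obj a))
  naturality a a' := by
    exact whisker_aux H (η.naturality a a') rfl (Category.assoc _ _ _).symm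

/-- Whiskering of `ε : R F ⟶ G` with `H`, giving `(H R) F ⟶ H G`. -/
@[simps]
def whiskerFrom {D : Type t} [EnrichedCategory V D] {F : EnrichedFunctor V A B}
    {G : EnrichedFunctor V A C} {R : EnrichedFunctor V B C} (ε : VNatTrans (F.comp V R) G)
    (H : EnrichedFunctor V C D) : VNatTrans (F.comp V (R.comp V H)) (G.comp V H) where
  app a := ε.app a ≫ H.map (R.obj (F.obj a)) (G.obj a)
  naturality a a' := by
    exact whisker_aux H (ε.naturality a a') (Category.assoc _ _ _).symm rfl

end NatTrans

/-! ### Pointwise Kan extensions and absolute (co)density -/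

section Kan

variable {V : Type v} [Category.{w} V] [MonoidalCategory V] [SymmetricCategory V]
  [MonoidalClosed V] {A : Type u₁} [EnrichedCategory V A] {B : Type u₂} [EnrichedCategory V B]
  {C : Type u₃} [EnrichedCategory V C]

/-- A cylinder `W ⟶ C(l, G-)` with vertex `l`, for a weight `W : A ⟶ V` and `G : A ⟶ C`:
a family `W a ⟶ C(l, Ga)` in `V` that is `V`-natural in `a`. -/
structure Cylinder (W : EnrichedFunctor V A V) (G : EnrichedFunctor V A C) (l : C) where
  /-- the components -/
  app (a : A) : W.obj a ⟶ (l ⟶[V] G.obj a)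
  naturality (a a' : A) :
    action W a a' ≫ app a' = (app a ⊗ₘ G.map a a') ≫ eComp V l (G.obj a) (G.obj a')

lemma cyl_aux {W W' X : V} {l x y : C} {act : W ⊗ X ⟶ W'} {m : W ⟶ (l ⟶[V] x)}
    {m' : W' ⟶ (l ⟶[V] y)} {g : X ⟶ (x ⟶[V] y)}
    (h : act ≫ m' = (m ⊗ₘ g) ≫ eComp V l x y) (c : C) :
    W ◁ (β_ (c ⟶[V] l) X).hom ≫ (α_ W X (c ⟶[V] l)).inv ≫ act ▷ (c ⟶[V] l) ≫
        (β_ W' (c ⟶[V] l)).hom ≫ (c ⟶[V] l) ◁ m' ≫ eComp V c l y =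
      (α_ W (c ⟶[V] l) X).inv ≫
        ((β_ W (c ⟶[V] l)).hom ≫ (c ⟶[V] l) ◁ m ≫ eComp V c l x) ▷ X ≫
          (c ⟶[V] x) ◁ g ≫ eComp V c x y := by
  have h1 : W ◁ (β_ (c ⟶[V] l) X).hom ≫ (α_ W X (c ⟶[V] l)).inv ≫
      (β_ (W ⊗ X) (c ⟶[V] l)).hom =
      (α_ W (c ⟶[V] l) X).inv ≫ (β_ W (c ⟶[V] l)).hom ▷ X ≫ (α_ (c ⟶[V] l) W X).hom := by
    rw [braiding_tensor_left_hom, Iso.inv_hom_id_assoc,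
      ← MonoidalCategory.whiskerLeft_comp_assoc, SymmetricCategory.symmetry]
    simp
  rw [braiding_naturality_left_assoc, reassoc_of% h1,
    ← MonoidalCategory.whiskerLeft_comp_assoc, h, MonoidalCategory.whiskerLeft_comp_assoc,
    ← e_assoc, MonoidalCategory.tensorHom_def]
  simp only [comp_whiskerRight, Category.assoc, MonoidalCategory.whiskerLeft_comp]
  rw [associator_inv_naturality_right_assoc, associator_inv_naturality_middle_assoc,
    Iso.hom_inv_id_assoc, whisker_exchange_assoc]

/-- The canonical family `C(c, l) ⟶ [W a, C(c, Ga)]`, `V`-natural in `a`, induced by a cylinder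
`W ⟶ C(l, G-)` and the composition of `C`. -/
@[simps]
def Cylinder.family {W : EnrichedFunctor V A V} {G : EnrichedFunctor V A C} {l : C}
    (μ : Cylinder W G l) (c : C) : VNatFamily (c ⟶[V] l) W (homFrom G c) where
  app a := MonoidalClosed.curry ((β_ (W.obj a) (c ⟶[V] l)).hom ≫
    (c ⟶[V] l) ◁ μ.app a ≫ eComp V c l (G.obj a))
  naturality a a' := by
    apply MonoidalClosed.uncurry_injective
    refine (MonoidalClosed.uncurry_natural_left _ _).trans ?_
    refine (congrArg (_ ≫ ·) (uncurry_tensorHom_comp _ _)).trans ?_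
    refine Eq.trans ?_ (uncurry_tensorHom_comp _ _).symm
    simp only [MonoidalClosed.uncurry_curry]
    have h : MonoidalClosed.uncurry ((homFrom G c).map a a') = _ := action_homFrom G c a a'
    rw [h]
    exact cyl_aux (μ.naturality a a') c

/-- The cylinder exhibits `l` as the weighted limit `{W, G}`:
`C(c, l) ≅ [A, V](W, C(c, G-))` for all `c`, through the canonical family. In particular the
object of `V`-natural transformations on the right exists. -/
def Cylinder.IsWeightedLimit {W : EnrichedFunctor V A V} {G : EnrichedFunctor V A C} {l : C}
    (μ : Cylinder W G l) : Prop :=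
  ∀ c : C, IsNatObject (μ.family c)

lemma ran_aux (R : EnrichedFunctor V B C) {X : V} {b x y : B} {z z' : C} {f : X ⟶ (x ⟶[V] y)}
    {g : X ⟶ (z ⟶[V] z')} {e : 𝟙_ V ⟶ (R.obj x ⟶[V] z)} {e' : 𝟙_ V ⟶ (R.obj y ⟶[V] z')}
    (h : (f ≫ R.map x y) ≫ postComp e' (R.obj x) = g ≫ preComp e z') :
    ((b ⟶[V] x) ◁ f ≫ eComp V b x y) ≫ R.map b y ≫ postComp e' (R.obj b) =
      ((R.map b x ≫ postComp e (R.obj b)) ⊗ₘ g) ≫ eComp V (R.obj b) z z' := by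
  have h1 : (b ⟶[V] x) ◁ f ≫ (R.map b x ⊗ₘ R.map x y) =
      R.map b x ▷ X ≫ (R.obj b ⟶[V] R.obj x) ◁ (f ≫ R.map x y) := by
    rw [MonoidalCategory.tensorHom_def, whisker_exchange_assoc,
      MonoidalCategory.whiskerLeft_comp]
  rw [Category.assoc, R.map_comp_assoc, eComp_postComp, reassoc_of% h1,
    ← MonoidalCategory.whiskerLeft_comp_assoc, h, MonoidalCategory.whiskerLeft_comp_assoc,
    preComp_eComp, MonoidalCategory.tensorHom_def, comp_whiskerRight, Category.assoc,
    Category.assoc, whisker_exchange_assoc]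

lemma lan_aux (L : EnrichedFunctor V B C) {X : V} {b x y : B} {z z' : C} {f : X ⟶ (x ⟶[V] y)}
    {g : X ⟶ (z ⟶[V] z')} {e : 𝟙_ V ⟶ (z ⟶[V] L.obj x)} {e' : 𝟙_ V ⟶ (z' ⟶[V] L.obj y)}
    (h : g ≫ postComp e' z = (f ≫ L.map x y) ≫ preComp e (L.obj y)) :
    ((y ⟶[V] b) ◁ f ≫ (β_ (y ⟶[V] b) (x ⟶[V] y)).hom ≫ eComp V x y b) ≫
        L.map x b ≫ preComp e (L.obj b) =
      ((L.map y b ≫ preComp e' (L.obj b)) ⊗ₘ g) ≫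
        (β_ (z' ⟶[V] L.obj b) (z ⟶[V] z')).hom ≫ eComp V z z' (L.obj b) := by
  have h1 : f ▷ (y ⟶[V] b) ≫ (L.map x y ⊗ₘ L.map y b) =
      X ◁ L.map y b ≫ (f ≫ L.map x y) ▷ (L.obj y ⟶[V] L.obj b) := by
    rw [tensorHom_def', ← whisker_exchange_assoc, comp_whiskerRight]
  simp only [Category.assoc]
  rw [braiding_naturality_right_assoc, L.map_comp_assoc, eComp_preComp, reassoc_of% h1,
    ← comp_whiskerRight_assoc, ← h, comp_whiskerRight_assoc, ← preComp_eComp,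
    braiding_naturality_assoc, tensorHom_def', MonoidalCategory.whiskerLeft_comp,
    Category.assoc, Category.assoc]
  simp only [whisker_exchange_assoc]

/-- For `ε : R F ⟶ G`, the cylinder `B(b, Fa) ⟶ C(Rb, RFa) ⟶ C(Rb, Ga)`. -/
@[simps]
def ranCylinder {F : EnrichedFunctor V A B} {G : EnrichedFunctor V A C}
    {R : EnrichedFunctor V B C} (ε : VNatTrans (F.comp V R) G) (b : B) :
    Cylinder (homFrom F b) G (R.obj b) where
  app a := R.map b (F.obj a) ≫ postComp (ε.app a) (R.obj b)
  naturality a a' := by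
    rw [action_homFrom]
    exact ran_aux R (ε.map_postComp a a')

/-- `ε : R F ⟶ G` exhibits `R` as the pointwise right Kan extension `Ran_F G`: for every `b`,
it exhibits `R b` as the weighted limit `{B(b, F-), G}`. -/
def IsPointwiseRan {F : EnrichedFunctor V A B} {G : EnrichedFunctor V A C}
    {R : EnrichedFunctor V B C} (ε : VNatTrans (F.comp V R) G) : Prop :=
  ∀ b : B, (ranCylinder ε b).IsWeightedLimit

/-- For `η : G ⟶ L F`, the cylinder `B(Fa, b) ⟶ C(LFa, Lb) ⟶ C(Ga, Lb)`, regarded as a cylinder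
over `Gᵒᵖ : Aᵒᵖ ⟶ Cᵒᵖ`. -/
@[simps]
def lanCylinder {F : EnrichedFunctor V A B} {G : EnrichedFunctor V A C}
    {L : EnrichedFunctor V B C} (η : VNatTrans G (F.comp V L)) (b : B) :
    Cylinder (homTo F b) (opFunctor G) (op (L.obj b)) where
  app a := L.map (F.obj a.unop) b ≫ preComp (η.app a.unop) (L.obj b)
  naturality a a' := by
    refine (congrArg (· ≫ _) (action_homTo F b a'.unop a.unop)).trans ?_
    exact lan_aux L (η.map_postComp a'.unop a.unop)

/-- `η : G ⟶ L F` exhibits `L` as the pointwise left Kan extension `Lan_F G`: for every `b`,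
it exhibits `L b` as the colimit of `G` weighted by `B(F-, b) : Aᵒᵖ ⟶ V`, i.e. as the limit of
`Gᵒᵖ : Aᵒᵖ ⟶ Cᵒᵖ` with that weight; explicitly `C(L b, c) ≅ [Aᵒᵖ, V](B(F-, b), C(G-, c))`. -/
def IsPointwiseLan {F : EnrichedFunctor V A B} {G : EnrichedFunctor V A C}
    {L : EnrichedFunctor V B C} (η : VNatTrans G (F.comp V L)) : Prop :=
  ∀ b : B, (lanCylinder η b).IsWeightedLimit

/-- `F` is dense: the identity `F ⟶ 1 F` exhibits `1` as `Lan_F F`. -/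
def IsDense (F : EnrichedFunctor V A B) : Prop :=
  IsPointwiseLan (idToComp F)

/-- `F` is codense: the identity `1 F ⟶ F` exhibits `1` as `Ran_F F`. -/
def IsCodense (F : EnrichedFunctor V A B) : Prop :=
  IsPointwiseRan (idFromComp F)

/-- `F` is absolutely dense: it is dense, and the pointwise Kan extension `Lan_F F = 1` is
preserved by every `V`-functor `H : B ⟶ D` (to a `V`-category `D` with objects in the universe `t`). -/
def AbsolutelyDense (F : EnrichedFunctor V A B) : Prop :=
  IsDense F ∧ ∀ (D : Type t) [EnrichedCategory V D] (H : EnrichedFunctor V B D),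
    IsPointwiseLan (whiskerTo (idToComp F) H)

/-- `F` is absolutely codense: it is codense, and the pointwise Kan extension `Ran_F F = 1` is
preserved by every `V`-functor `H : B ⟶ D` (to a `V`-category `D` with objects in the universe `t`). -/
def AbsolutelyCodense (F : EnrichedFunctor V A B) : Prop :=
  IsCodense F ∧ ∀ (D : Type t) [EnrichedCategory V D] (H : EnrichedFunctor V B D),
    IsPointwiseRan (whiskerFrom (idFromComp F) H)

end Kan

end EnrichedDensity

end

/-! Cauchy density says that the composition maps `B(b, Fa) ⊗ B(Fa, b') ⟶ B(b, b')` form a coend in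
`a`; this is `CompUniversal F`. By the symmetry of `V` the condition is self-dual, so it is
equivalent to `CompUniversal (opFunctor F)`. One argument therefore serves right Kan extensions,
applied to `F`, and left ones, applied to `Fᵒᵖ`.

From universality to absoluteness (`CompUniversal.existsUnique`): let `t a : X ⊗ B(b, Fa) ⟶ D(c,
HFa)` be natural in `a`. Because `X ⊗ -` is a left adjoint, it preserves the coend, and `t` extends
uniquely along `F` to a family `φ b' : X ⊗ B(b, b') ⟶ D(c, Hb')`, natural in `b'`. By the Yoneda
lemma, `φ` comes from exactly one map `X ⟶ D(c, Hb)`, its value at the identity of `b`. This is the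
universal property of `Hb` as the limit of `HF` weighted by `B(b, F-)`.

Conversely (`compUniversal_of_existsUnique`), it suffices to test preservation on one representable
for each `b'`. For `H = B(-, b') : B ⟶ Vᵒᵖ`, test object `Y` and `X = 𝟙_ V`, a natural family `B(b,
Fa) ⟶ [B(Fa, b'), Y]` is a balanced family with values in `Y`, and a map `𝟙_ V ⟶ [B(b, b'), Y]` is a
map `B(b, b') ⟶ Y`. -/

namespace EnrichedDensity

open CategoryTheory MonoidalCategory BraidedCategory Opposite
open scoped CategoryTheory.MonoidalClosed

/-! ### Cauchy density in diagrammatic order -/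

section Balanced

variable {V : Type v} [Category.{w} V] [MonoidalCategory V]
  {A : Type u₁} [EnrichedCategory V A] {B : Type u₂} [EnrichedCategory V B]

/-- A family `B(b, Fa) ⊗ B(Fa, b') ⟶ Y` is balanced if it coequalizes the two actions of
`A(a, a')` on `B(b, Fa) ⊗ B(Fa', b')`. -/
def Balanced (F : EnrichedFunctor V A B) {b b' : B} {Y : V}
    (k : ∀ a, (b ⟶[V] F.obj a) ⊗ (F.obj a ⟶[V] b') ⟶ Y) : Prop :=
  ∀ a a', (α_ _ _ _).hom ≫ (b ⟶[V] F.obj a) ◁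
      (F.map a a' ▷ (F.obj a' ⟶[V] b') ≫ eComp V (F.obj a) (F.obj a') b') ≫ k a =
    ((b ⟶[V] F.obj a) ◁ F.map a a' ≫ eComp V b (F.obj a) (F.obj a')) ▷ (F.obj a' ⟶[V] b') ≫ k a'

/-- The composition maps `B(b, Fa) ⊗ B(Fa, b') ⟶ B(b, b')` are universal among balanced
families. -/
def CompUniversal (F : EnrichedFunctor V A B) : Prop :=
  ∀ (b b' : B) (Y : V) (k : ∀ a, (b ⟶[V] F.obj a) ⊗ (F.obj a ⟶[V] b') ⟶ Y), Balanced F k →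
    ∃! f : (b ⟶[V] b') ⟶ Y, ∀ a, eComp V b (F.obj a) b' ≫ f = k a

end Balanced

section Cauchy

variable {V : Type v} [Category.{w} V] [MonoidalCategory V] [SymmetricCategory V]
  [MonoidalClosed V] {A : Type u₁} [EnrichedCategory V A] {B : Type u₂} [EnrichedCategory V B]

/-- Being a coend transfers along the isomorphism `ε`, so the composition cowedge itself may be
taken as the coend. -/
lemma cauchyDense_iff_isCoend (F : EnrichedFunctor V A B) :
    CauchyDense F ↔ ∀ b b', (compCowedge F b b').IsCoend := by
  refine forall₂_congr fun b b' ↦ ⟨?_, fun h ↦ ⟨_, h, 𝟙 (b ⟶[V] b'),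
    fun a ↦ Category.comp_id _, IsIso.id (b ⟶[V] b')⟩⟩
  rintro ⟨c, hc, ε, hε, hiso⟩ d
  obtain ⟨f, hf, huniq⟩ := hc d
  refine ⟨inv (I := hiso) ε ≫ f, fun a ↦ ?_, fun g hg ↦ ?_⟩
  · rw [← hf, ← hε]
    exact (Category.assoc _ _ _).trans (congrArg _ (IsIso.hom_inv_id_assoc (I := hiso) ε f))
  · have hg' : ε ≫ g = f := huniq _ fun a ↦ by
      refine (Category.assoc _ _ _).symm.trans ?_
      rw [hε]
      exact hg a
    rw [← hg']
    exact (IsIso.inv_hom_id_assoc (I := hiso) ε g).symm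

/-- A cowedge lists the contravariant factor first. Moving the braiding to the front of both sides
of its condition exposes the same isomorphism on each, and cancelling it leaves the balancing
equation. -/
lemma balanced_iff (F : EnrichedFunctor V A B) {b b' : B} {Y : V}
    (k : ∀ a, (b ⟶[V] F.obj a) ⊗ (F.obj a ⟶[V] b') ⟶ Y) :
    Balanced F k ↔ ∀ a a',
      (homTo F b').obj (op a') ◁ action (homFrom F b) a a' ≫ (β_ _ _).hom ≫ k a' =
      (homTo F b').obj (op a') ◁ (β_ ((homFrom F b).obj a) (a ⟶[V] a')).hom ≫
        (α_ ((homTo F b').obj (op a')) (a ⟶[V] a') ((homFrom F b).obj a)).inv ≫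
          action (homTo F b') (op a') (op a) ▷ (homFrom F b).obj a ≫ (β_ _ _).hom ≫ k a := by
  refine forall₂_congr fun a a' ↦ ?_
  rw [action_homFrom, action_homTo]
  have h := braiding_tensor_swap (F.obj a' ⟶[V] b') (b ⟶[V] F.obj a) (a ⟶[V] a')
  have e₁ : (F.obj a' ⟶[V] b') ◁ ((b ⟶[V] F.obj a) ◁ F.map a a' ≫
        eComp V b (F.obj a) (F.obj a')) ≫ (β_ _ _).hom ≫ k a' =
      (β_ _ _).hom ≫ ((b ⟶[V] F.obj a) ◁ F.map a a' ≫ eComp V b (F.obj a) (F.obj a')) ▷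
        (F.obj a' ⟶[V] b') ≫ k a' := by
    rw [braiding_naturality_right_assoc]
  have e₂ : (F.obj a' ⟶[V] b') ◁ (β_ (b ⟶[V] F.obj a) (a ⟶[V] a')).hom ≫
        (α_ (F.obj a' ⟶[V] b') (a ⟶[V] a') (b ⟶[V] F.obj a)).inv ≫
          ((F.obj a' ⟶[V] b') ◁ F.map a a' ≫ (β_ (F.obj a' ⟶[V] b') _).hom ≫
            eComp V (F.obj a) (F.obj a') b') ▷ (b ⟶[V] F.obj a) ≫ (β_ _ _).hom ≫ k a =
      (β_ _ _).hom ≫ (α_ _ _ _).hom ≫ (b ⟶[V] F.obj a) ◁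
        (F.map a a' ▷ (F.obj a' ⟶[V] b') ≫ eComp V (F.obj a) (F.obj a') b') ≫ k a := by
    rw [braiding_naturality_right_assoc, comp_whiskerRight, Category.assoc,
      braiding_naturality_left_assoc, reassoc_of% h]
  refine Iff.trans ?_ (Eq.congr e₁.symm e₂.symm).symm.symm
  rw [cancel_epi]
  exact eq_comm

lemma cauchyDense_iff_compUniversal (F : EnrichedFunctor V A B) :
    CauchyDense F ↔ CompUniversal F := by
  rw [cauchyDense_iff_isCoend]
  refine forall₂_congr fun b b' ↦ ⟨fun h Y k hk ↦ ?_, fun h d ↦ ?_⟩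
  · obtain ⟨f, hf, hu⟩ := h ⟨Y, fun a ↦ (β_ _ _).hom ≫ k a, (balanced_iff F k).1 hk⟩
    refine ⟨f, fun a ↦ ?_, fun g hg ↦ hu g fun a ↦ ?_⟩
    · exact (cancel_epi (β_ (F.obj a ⟶[V] b') (b ⟶[V] F.obj a)).hom).1
        ((Category.assoc _ _ _).symm.trans (hf a))
    · exact (Category.assoc _ _ _).trans (congrArg _ (hg a))
  · have hk : Balanced F fun a ↦ (β_ _ _).hom ≫ d.ι a := by
      rw [balanced_iff]
      intro a a'
      refine Eq.trans ?_ ((d.condition a a').trans ?_)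
      · exact congrArg _ (SymmetricCategory.symmetry_assoc _ _ _)
      · exact congrArg (fun g ↦ _ ≫ _ ≫ _ ≫ g) (SymmetricCategory.symmetry_assoc _ _ _).symm
    obtain ⟨f, hf, hu⟩ := h _ _ hk
    refine ⟨f, fun a ↦ ?_, fun g hg ↦ hu g fun a ↦ ?_⟩
    · refine (Category.assoc _ _ _).trans ((congrArg _ (hf a)).trans ?_)
      exact SymmetricCategory.symmetry_assoc _ _ _
    · refine Eq.trans ?_ (congrArg _ (hg a))
      refine Eq.trans ?_ (congrArg _ (Category.assoc _ _ _).symm)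
      exact (SymmetricCategory.symmetry_assoc _ _ _).symm

/-- Passing to opposites already puts the factors in the order of a cowedge, so `k` needs no
braiding; only `A(a, a')` has to be moved past `B(b, Fa)`, and `a`, `a'` exchange roles. -/
lemma balanced_op_iff (F : EnrichedFunctor V A B) {b b' : B} {Y : V}
    (k : ∀ a, (F.obj a ⟶[V] b') ⊗ (b ⟶[V] F.obj a) ⟶ Y) :
    Balanced (opFunctor F) (b := op b') (b' := op b) (fun a ↦ k a.unop) ↔ ∀ a a',
      (homTo F b').obj (op a') ◁ action (homFrom F b) a a' ≫ k a' =
      (homTo F b').obj (op a') ◁ (β_ ((homFrom F b).obj a) (a ⟶[V] a')).hom ≫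
        (α_ ((homTo F b').obj (op a')) (a ⟶[V] a') ((homFrom F b).obj a)).inv ≫
          action (homTo F b') (op a') (op a) ▷ (homFrom F b).obj a ≫ k a := by
  have key : ∀ a a', ((α_ (F.obj a' ⟶[V] b') (a ⟶[V] a') (b ⟶[V] F.obj a)).hom ≫
      (F.obj a' ⟶[V] b') ◁ (F.map a a' ▷ (b ⟶[V] F.obj a) ≫ (β_ _ _).hom ≫
        eComp V b (F.obj a) (F.obj a')) ≫ k a' =
      ((F.obj a' ⟶[V] b') ◁ F.map a a' ≫ (β_ (F.obj a' ⟶[V] b') (F.obj a ⟶[V] F.obj a')).hom ≫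
        eComp V (F.obj a) (F.obj a') b') ▷ (b ⟶[V] F.obj a) ≫ k a) ↔
      (F.obj a' ⟶[V] b') ◁ ((b ⟶[V] F.obj a) ◁ F.map a a' ≫
        eComp V b (F.obj a) (F.obj a')) ≫ k a' =
      (F.obj a' ⟶[V] b') ◁ (β_ (b ⟶[V] F.obj a) (a ⟶[V] a')).hom ≫
        (α_ (F.obj a' ⟶[V] b') (a ⟶[V] a') (b ⟶[V] F.obj a)).inv ≫
      ((F.obj a' ⟶[V] b') ◁ F.map a a' ≫ (β_ (F.obj a' ⟶[V] b') (F.obj a ⟶[V] F.obj a')).hom ≫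
        eComp V (F.obj a) (F.obj a') b') ▷ (b ⟶[V] F.obj a) ≫ k a := by
    intro a a'
    rw [← Iso.eq_inv_comp, ← cancel_epi
      ((F.obj a' ⟶[V] b') ◁ (β_ (b ⟶[V] F.obj a) (a ⟶[V] a')).hom),
      braiding_naturality_left_assoc, ← MonoidalCategory.whiskerLeft_comp_assoc,
      SymmetricCategory.symmetry_assoc]
  constructor
  · intro h a a'
    rw [action_homFrom, action_homTo]
    exact (key a a').1 (h (op a') (op a))
  · intro h a a'
    have := h a'.unop a.unop
    rw [action_homFrom, action_homTo] at this
    exact (key _ _).2 this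

lemma cauchyDense_iff_compUniversal_op (F : EnrichedFunctor V A B) :
    CauchyDense F ↔ CompUniversal (opFunctor F) := by
  rw [cauchyDense_iff_isCoend]
  refine ⟨fun h b' b Y k hk ↦ ?_, fun h b b' d ↦ ?_⟩
  · obtain ⟨f, hf, hu⟩ := h b.unop b'.unop ⟨Y, fun a ↦ k (op a), (balanced_op_iff F _).1 hk⟩
    exact ⟨f, fun a ↦ hf a.unop, fun g hg ↦ hu g fun a ↦ hg (op a)⟩
  · obtain ⟨f, hf, hu⟩ := h (op b') (op b) d.pt (fun a ↦ d.ι a.unop)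
      ((balanced_op_iff F _).2 d.condition)
    exact ⟨f, fun a ↦ hf (op a), fun g hg ↦ hu g fun a ↦ hg a.unop⟩

end Cauchy

/-! ### Weighted limits in uncurried form -/

section Natural

variable {V : Type v} [Category.{w} V] [MonoidalCategory V] [SymmetricCategory V]
  [MonoidalClosed V] {A : Type u₁} [EnrichedCategory V A] {C : Type u₃} [EnrichedCategory V C]

/-- `V`-naturality in `a` of a family `X ⊗ W a ⟶ C(c, Ga)`. -/
def IsNatural (W : EnrichedFunctor V A V) (G : EnrichedFunctor V A C) {c : C} {X : V}
    (t : ∀ a, X ⊗ W.obj a ⟶ (c ⟶[V] G.obj a)) : Prop :=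
  ∀ a a', X ◁ action W a a' ≫ t a' =
    (α_ X (W.obj a) (a ⟶[V] a')).inv ≫ (t a ⊗ₘ G.map a a') ≫ eComp V c (G.obj a) (G.obj a')

/-- After uncurrying, both sides of the naturality square start with the same isomorphism, an
associator followed by a braiding, which cancels. -/
lemma isNatural_iff (W : EnrichedFunctor V A V) (G : EnrichedFunctor V A C) {c : C} {X : V}
    (t : ∀ a, X ⊗ W.obj a ⟶ (c ⟶[V] G.obj a)) :
    IsNatural W G t ↔ ∀ a a' : A,
      (β_ X (a ⟶[V] a')).hom ≫
        (W.map a a' ⊗ₘ MonoidalClosed.curry ((β_ (W.obj a') X).hom ≫ t a')) ≫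
          eComp V (W.obj a) (W.obj a') ((homFrom G c).obj a') =
      (MonoidalClosed.curry ((β_ (W.obj a) X).hom ≫ t a) ⊗ₘ (homFrom G c).map a a') ≫
        eComp V (W.obj a) ((homFrom G c).obj a) ((homFrom G c).obj a') := by
  refine forall₂_congr fun a a' ↦ ?_
  have e₁ : MonoidalClosed.uncurry ((β_ X (a ⟶[V] a')).hom ≫
      (W.map a a' ⊗ₘ MonoidalClosed.curry ((β_ (W.obj a') X).hom ≫ t a')) ≫
        eComp V (W.obj a) (W.obj a') ((homFrom G c).obj a')) =
      (α_ (W.obj a) X (a ⟶[V] a')).inv ≫ (β_ (W.obj a) X).hom ▷ (a ⟶[V] a') ≫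
        (α_ X (W.obj a) (a ⟶[V] a')).hom ≫ X ◁ action W a a' ≫ t a' := by
    refine (MonoidalClosed.uncurry_natural_left _ _).trans ?_
    refine (congrArg (_ ≫ ·) (uncurry_tensorHom_comp _ _)).trans ?_
    refine (congrArg (_ ≫ _ ≫ _ ≫ ·) (MonoidalClosed.uncurry_curry _)).trans ?_
    have h : W.obj a ◁ (β_ X (a ⟶[V] a')).hom ≫ (α_ (W.obj a) (a ⟶[V] a') X).inv ≫
        (β_ (W.obj a ⊗ (a ⟶[V] a')) X).hom =
        (α_ (W.obj a) X (a ⟶[V] a')).inv ≫ (β_ (W.obj a) X).hom ▷ (a ⟶[V] a') ≫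
          (α_ X (W.obj a) (a ⟶[V] a')).hom := by
      rw [braiding_tensor_left_hom, Iso.inv_hom_id_assoc,
        ← MonoidalCategory.whiskerLeft_comp_assoc, SymmetricCategory.symmetry]
      simp
    change W.obj a ◁ (β_ X (a ⟶[V] a')).hom ≫ (α_ (W.obj a) (a ⟶[V] a') X).inv ≫
      action W a a' ▷ X ≫ (β_ (W.obj a') X).hom ≫ t a' = _
    rw [braiding_naturality_left_assoc, reassoc_of% h]
  have e₂ : MonoidalClosed.uncurry
      ((MonoidalClosed.curry ((β_ (W.obj a) X).hom ≫ t a) ⊗ₘ (homFrom G c).map a a') ≫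
        eComp V (W.obj a) ((homFrom G c).obj a) ((homFrom G c).obj a')) =
      (α_ (W.obj a) X (a ⟶[V] a')).inv ≫ (β_ (W.obj a) X).hom ▷ (a ⟶[V] a') ≫
        (t a ⊗ₘ G.map a a') ≫ eComp V c (G.obj a) (G.obj a') := by
    refine (uncurry_tensorHom_comp _ _).trans ?_
    refine (congrArg₂ (fun f g ↦ _ ≫ f ▷ _ ≫ g) (MonoidalClosed.uncurry_curry _)
      (action_homFrom G c a a')).trans ?_
    change (α_ (W.obj a) X (a ⟶[V] a')).inv ≫ ((β_ (W.obj a) X).hom ≫ t a) ▷ (a ⟶[V] a') ≫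
      (c ⟶[V] G.obj a) ◁ G.map a a' ≫ eComp V c (G.obj a) (G.obj a') = _
    rw [MonoidalCategory.tensorHom_def, comp_whiskerRight, Category.assoc, Category.assoc]
  refine Iff.trans ?_ MonoidalClosed.uncurry_injective.eq_iff
  refine Iff.trans ?_ (Eq.congr e₁ e₂).symm
  refine Iff.trans ?_ ((cancel_epi _).trans (cancel_epi _)).symm
  exact Iso.eq_inv_comp _

/-- The tensor-hom adjunction removes the internal homs from the universal property, so that
afterwards only composition in `C` has to be handled. -/
lemma Cylinder.isWeightedLimit_iff {W : EnrichedFunctor V A V} {G : EnrichedFunctor V A C} {l : C}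
    (μ : Cylinder W G l) :
    μ.IsWeightedLimit ↔ ∀ (c : C) (X : V) (t : ∀ a, X ⊗ W.obj a ⟶ (c ⟶[V] G.obj a)),
      IsNatural W G t →
        ∃! f : X ⟶ (c ⟶[V] l), ∀ a, (f ⊗ₘ μ.app a) ≫ eComp V c l (G.obj a) = t a := by
  have key : ∀ (c : C) {X : V} (f : X ⟶ (c ⟶[V] l)) (a : A)
      (s : X ⊗ W.obj a ⟶ (c ⟶[V] G.obj a)),
      f ≫ (μ.family c).app a = MonoidalClosed.curry ((β_ (W.obj a) X).hom ≫ s) ↔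
        (f ⊗ₘ μ.app a) ≫ eComp V c l (G.obj a) = s := by
    intro c X f a s
    have e : f ≫ (μ.family c).app a = MonoidalClosed.curry ((β_ (W.obj a) X).hom ≫
        (f ⊗ₘ μ.app a) ≫ eComp V c l (G.obj a)) := by
      apply MonoidalClosed.uncurry_injective
      refine (uncurry_comp_curry _ _).trans (Eq.trans ?_ (MonoidalClosed.uncurry_curry _).symm)
      rw [braiding_naturality_right_assoc,
        MonoidalCategory.tensorHom_def_assoc]
      rfl
    rw [e]
    exact MonoidalClosed.curry_injective.eq_iff.trans (cancel_epi _)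
  refine forall₂_congr fun c X ↦ ⟨fun h t ht ↦ ?_, fun h τ ↦ ?_⟩
  · obtain ⟨f, hf, hu⟩ := h ⟨_, (isNatural_iff W G t).1 ht⟩
    exact ⟨f, fun a ↦ (key c f a _).1 (hf a), fun g hg ↦ hu g fun a ↦ (key c g a _).2 (hg a)⟩
  · have hτ : ∀ a, MonoidalClosed.curry ((β_ (W.obj a) X).hom ≫
        (β_ X (W.obj a)).hom ≫ MonoidalClosed.uncurry (τ.app a)) = τ.app a := fun a ↦ by
      rw [SymmetricCategory.symmetry_assoc]
      exact MonoidalClosed.curry_uncurry _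
    obtain ⟨f, hf, hu⟩ := h (fun a ↦ (β_ X (W.obj a)).hom ≫ MonoidalClosed.uncurry (τ.app a))
      ((isNatural_iff W G _).2 fun a a' ↦
        (congrArg (fun g ↦ _ ≫ (_ ⊗ₘ g) ≫ _) (hτ a')).trans ((τ.naturality a a').trans
          (congrArg (fun g ↦ (g ⊗ₘ _) ≫ _) (hτ a)).symm))
    exact ⟨f, fun a ↦ ((key c f a _).2 (hf a)).trans (hτ a),
      fun g hg ↦ hu g fun a ↦ (key c g a _).1 ((hg a).trans (hτ a).symm)⟩

end Natural

/-! ### Universality of composition implies absolute (co)density -/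

section Forward

variable {V : Type v} [Category.{w} V] [MonoidalCategory V] {A : Type u₁} [EnrichedCategory V A]
  {B : Type u₂} [EnrichedCategory V B] {D : Type u₃} [EnrichedCategory V D]

lemma tensorHom_eComp_tensorHom {P Q R : V} {x y z z' : D} (p : P ⟶ (x ⟶[V] y))
    (q : Q ⟶ (y ⟶[V] z)) (r : R ⟶ (z ⟶[V] z')) :
    (p ⊗ₘ ((q ⊗ₘ r) ≫ eComp V y z z')) ≫ eComp V x y z' =
      (α_ P Q R).inv ≫ (((p ⊗ₘ q) ≫ eComp V x y z) ⊗ₘ r) ≫ eComp V x z z' := by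
  rw [MonoidalCategory.tensorHom_def p, MonoidalCategory.whiskerLeft_comp, Category.assoc,
    Category.assoc, ← e_assoc, MonoidalCategory.tensorHom_def (_ ≫ _) r, comp_whiskerRight]
  simp only [MonoidalCategory.tensorHom_def, MonoidalCategory.whiskerLeft_comp, comp_whiskerRight,
    Category.assoc]
  rw [← whisker_exchange_assoc (eComp V x y z) r]
  simp

/-- Associativity in `D` combined with functoriality of `H`, for generalized elements `p`, `q`, `r`.
-/
lemma tensorHom_eComp_map (H : EnrichedFunctor V B D) {P Q R : V} {x : D} {y z z' : B}
    (p : P ⟶ (x ⟶[V] H.obj y)) (q : Q ⟶ (y ⟶[V] z)) (r : R ⟶ (z ⟶[V] z')) :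
    P ◁ ((q ⊗ₘ r) ≫ eComp V y z z') ≫ (p ⊗ₘ H.map y z') ≫ eComp V x (H.obj y) (H.obj z') =
      (α_ P Q R).inv ≫ (((p ⊗ₘ (q ≫ H.map y z)) ≫ eComp V x (H.obj y) (H.obj z)) ⊗ₘ
        (r ≫ H.map z z')) ≫ eComp V x (H.obj z) (H.obj z') := by
  rw [← tensorHom_eComp_tensorHom, ← tensorHom_comp_tensorHom, Category.assoc, ← H.map_comp,
    ← id_tensorHom, tensorHom_comp_tensorHom_assoc, Category.id_comp, Category.assoc]

/-- Half of the Yoneda lemma: an element is recovered by evaluating the family it induces at the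
identity. -/
lemma eId_tensorHom_eComp (H : EnrichedFunctor V B D) {P : V} {x : D} {y : B}
    (p : P ⟶ (x ⟶[V] H.obj y)) :
    (ρ_ P).inv ≫ P ◁ eId V y ≫ (p ⊗ₘ H.map y y) ≫ eComp V x (H.obj y) (H.obj y) = p := by
  rw [tensorHom_def', Category.assoc, ← MonoidalCategory.whiskerLeft_comp_assoc, H.map_id,
    whisker_exchange_assoc,
    ← rightUnitor_inv_naturality_assoc, e_comp_id, Category.comp_id]

lemma balanced_eComp (F : EnrichedFunctor V A B) {b b' : B} {Y : V} (u : (b ⟶[V] b') ⟶ Y) :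
    Balanced F fun a ↦ eComp V b (F.obj a) b' ≫ u := by
  intro a a'
  simp only [MonoidalCategory.whiskerLeft_comp, comp_whiskerRight, Category.assoc]
  rw [← e_assoc_assoc, ← associator_naturality_middle_assoc, Iso.hom_inv_id_assoc]

lemma CompUniversal.hom_ext {F : EnrichedFunctor V A B} (hF : CompUniversal F) {b b' : B} {Y : V}
    {u u' : (b ⟶[V] b') ⟶ Y}
    (h : ∀ a, eComp V b (F.obj a) b' ≫ u = eComp V b (F.obj a) b' ≫ u') : u = u' :=
  (hF b b' Y _ (balanced_eComp F u')).unique h fun _ ↦ rfl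

variable [MonoidalClosed V]

/-- Currying out `X` reduces to `CompUniversal.hom_ext`: the left adjoint `X ⊗ -` keeps the
composition maps jointly epic. -/
lemma CompUniversal.tensor_hom_ext {F : EnrichedFunctor V A B} (hF : CompUniversal F) {b b' : B}
    {X Y : V} {u u' : X ⊗ (b ⟶[V] b') ⟶ Y}
    (h : ∀ a, X ◁ eComp V b (F.obj a) b' ≫ u = X ◁ eComp V b (F.obj a) b' ≫ u') : u = u' := by
  apply MonoidalClosed.curry_injective
  refine hF.hom_ext fun a ↦ ?_
  rw [← MonoidalClosed.curry_natural_left, ← MonoidalClosed.curry_natural_left, h]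

lemma CompUniversal.tensor_hom_ext_right [BraidedCategory V] {F : EnrichedFunctor V A B}
    (hF : CompUniversal F) {b b' : B} {X Y Z : V} {u u' : (X ⊗ (b ⟶[V] b')) ⊗ Z ⟶ Y}
    (h : ∀ a, (X ◁ eComp V b (F.obj a) b') ▷ Z ≫ u = (X ◁ eComp V b (F.obj a) b') ▷ Z ≫ u') :
    u = u' := by
  rw [← cancel_epi (β_ Z (X ⊗ (b ⟶[V] b'))).hom]
  apply MonoidalClosed.curry_injective
  refine hF.tensor_hom_ext fun a ↦ ?_
  rw [← MonoidalClosed.curry_natural_left, ← MonoidalClosed.curry_natural_left,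
    braiding_naturality_right_assoc, braiding_naturality_right_assoc, h]

lemma CompUniversal.exists_tensor_desc {F : EnrichedFunctor V A B} (hF : CompUniversal F)
    {b b' : B} {X Y : V} (k : ∀ a, X ⊗ ((b ⟶[V] F.obj a) ⊗ (F.obj a ⟶[V] b')) ⟶ Y)
    (hk : Balanced F fun a ↦ MonoidalClosed.curry (k a)) :
    ∃ φ : X ⊗ (b ⟶[V] b') ⟶ Y, ∀ a, X ◁ eComp V b (F.obj a) b' ≫ φ = k a := by
  obtain ⟨f, hf, -⟩ := hF b b' _ _ hk
  refine ⟨MonoidalClosed.uncurry f, fun a ↦ ?_⟩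
  rw [← MonoidalClosed.uncurry_natural_left, hf, MonoidalClosed.uncurry_curry]

/-- The family "apply `t a`, then act by `H` on `B(Fa, b')`" is balanced precisely because `t` is
natural in `a`, so it descends to `X ⊗ B(b, b')`. -/
lemma CompUniversal.exists_extension {F : EnrichedFunctor V A B} (hF : CompUniversal F)
    (H : EnrichedFunctor V B D) {b : B} {c : D} {X : V}
    (t : ∀ a, X ⊗ (b ⟶[V] F.obj a) ⟶ (c ⟶[V] H.obj (F.obj a)))
    (ht : ∀ a a', X ◁ ((b ⟶[V] F.obj a) ◁ F.map a a' ≫ eComp V b (F.obj a) (F.obj a')) ≫ t a' =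
      (α_ X (b ⟶[V] F.obj a) (a ⟶[V] a')).inv ≫
        (t a ⊗ₘ (F.map a a' ≫ H.map (F.obj a) (F.obj a'))) ≫
          eComp V c (H.obj (F.obj a)) (H.obj (F.obj a'))) (b' : B) :
    ∃ φ : X ⊗ (b ⟶[V] b') ⟶ (c ⟶[V] H.obj b'), ∀ a, X ◁ eComp V b (F.obj a) b' ≫ φ =
      (α_ _ _ _).inv ≫ (t a ⊗ₘ H.map (F.obj a) b') ≫ eComp V c (H.obj (F.obj a)) (H.obj b') := by
  refine hF.exists_tensor_desc _ fun a a' ↦ ?_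
  beta_reduce
  rw [← Category.assoc, ← MonoidalClosed.curry_natural_left, ← MonoidalClosed.curry_natural_left]
  congr 1
  have e₁ := tensorHom_eComp_map H (t a) (F.map a a') (𝟙 (F.obj a' ⟶[V] b'))
  rw [tensorHom_id, Category.id_comp] at e₁
  rw [associator_inv_naturality_middle_assoc, whiskerRight_comp_tensorHom_assoc, ht,
    MonoidalCategory.whiskerLeft_comp,
    Category.assoc, associator_inv_naturality_right_assoc, e₁,
    pentagon_hom_inv_inv_inv_inv_assoc, whiskerRight_comp_tensorHom_assoc]

lemma CompUniversal.existsUnique [BraidedCategory V] {F : EnrichedFunctor V A B}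
    (hF : CompUniversal F) (H : EnrichedFunctor V B D) {b : B} {c : D} {X : V}
    (t : ∀ a, X ⊗ (b ⟶[V] F.obj a) ⟶ (c ⟶[V] H.obj (F.obj a)))
    (ht : ∀ a a', X ◁ ((b ⟶[V] F.obj a) ◁ F.map a a' ≫ eComp V b (F.obj a) (F.obj a')) ≫ t a' =
      (α_ X (b ⟶[V] F.obj a) (a ⟶[V] a')).inv ≫
        (t a ⊗ₘ (F.map a a' ≫ H.map (F.obj a) (F.obj a'))) ≫
          eComp V c (H.obj (F.obj a)) (H.obj (F.obj a'))) :
    ∃! f : X ⟶ (c ⟶[V] H.obj b), ∀ a, (f ⊗ₘ H.map b (F.obj a)) ≫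
      eComp V c (H.obj b) (H.obj (F.obj a)) = t a := by
  choose φ hφ using hF.exists_extension H t ht
  -- Naturality of `φ` in `b'`, checked on the jointly epic maps out of `B(b, Fa) ⊗ B(Fa, b')`.
  have hnat : ∀ b' b'', X ◁ eComp V b b' b'' ≫ φ b'' =
      (α_ _ _ _).inv ≫ (φ b' ⊗ₘ H.map b' b'') ≫ eComp V c (H.obj b') (H.obj b'') := by
    intro b' b''
    rw [Iso.eq_inv_comp]
    refine hF.tensor_hom_ext_right fun a ↦ ?_
    have e₁ := tensorHom_eComp_map H (t a) (𝟙 (F.obj a ⟶[V] b')) (𝟙 (b' ⟶[V] b''))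
    simp only [id_tensorHom_id, Category.id_comp] at e₁
    rw [associator_naturality_middle_assoc, ← MonoidalCategory.whiskerLeft_comp_assoc, ← e_assoc',
      MonoidalCategory.whiskerLeft_comp_assoc, MonoidalCategory.whiskerLeft_comp_assoc, hφ,
      associator_inv_naturality_right_assoc, e₁,
      pentagon_hom_inv_inv_inv_inv_assoc, Iso.hom_inv_id_assoc,
      whiskerRight_comp_tensorHom_assoc, whiskerRight_comp_tensorHom_assoc, hφ]
  -- `φ` restricts to `t` along `F`: insert the identity of `Fa` in the defining equation of `φ
  -- (F.obj a)`.
  have hφt : ∀ a, φ (F.obj a) = t a := by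
    intro a
    have := (ρ_ _).inv ≫= (X ⊗ (b ⟶[V] F.obj a)) ◁ eId V (F.obj a) ≫= (α_ _ _ _).hom ≫=
      hφ (F.obj a) a
    rw [Iso.hom_inv_id_assoc, eId_tensorHom_eComp, associator_naturality_right_assoc,
      ← MonoidalCategory.whiskerLeft_comp_assoc, rightUnitor_tensor_inv, Category.assoc,
      Iso.inv_hom_id_assoc, ← MonoidalCategory.whiskerLeft_comp_assoc, e_comp_id] at this
    simpa using this
  -- The Yoneda element: `φ b` evaluated at the identity of `b`.
  refine ⟨(ρ_ X).inv ≫ X ◁ eId V b ≫ φ b, fun a ↦ ?_, fun g hg ↦ ?_⟩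
  · have h := hnat b (F.obj a)
    rw [hφt, Iso.eq_inv_comp] at h
    rw [← whiskerRight_comp_tensorHom_assoc, ← whiskerRight_comp_tensorHom_assoc, ← h,
      associator_naturality_middle_assoc,
      ← MonoidalCategory.whiskerLeft_comp_assoc, triangle_assoc_comp_right_inv_assoc,
      ← MonoidalCategory.whiskerLeft_comp_assoc, e_id_comp,
      MonoidalCategory.whiskerLeft_id, Category.id_comp]
  · have hgφ : (g ⊗ₘ H.map b b) ≫ eComp V c (H.obj b) (H.obj b) = φ b := by
      refine hF.tensor_hom_ext fun a ↦ ?_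
      have := tensorHom_eComp_map H g (𝟙 (b ⟶[V] F.obj a)) (𝟙 (F.obj a ⟶[V] b))
      simp only [id_tensorHom_id, Category.id_comp] at this
      rw [this, hg, hφ]
    rw [← hgφ, eId_tensorHom_eComp]

end Forward

/-! ### Kan extensions along `F` obtained from universal composition -/

section Forward

variable {V : Type v} [Category.{w} V] [MonoidalCategory V]

lemma postComp_eId {C : Type u₃} [EnrichedCategory V C] (x y : C) :
    postComp (eId V y) x = 𝟙 (x ⟶[V] y) :=
  e_comp_id V x y

lemma preComp_eId {C : Type u₃} [EnrichedCategory V C] (y x : C) :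
    preComp (eId V y) x = 𝟙 (y ⟶[V] x) :=
  e_id_comp V y x

variable [SymmetricCategory V] [MonoidalClosed V] {A : Type u₁} [EnrichedCategory V A]
  {B : Type u₂} [EnrichedCategory V B] {D : Type u₃} [EnrichedCategory V D]
  {F : EnrichedFunctor V A B}

lemma isNatural_homFrom_iff {b : B} {G : EnrichedFunctor V A D} {c : D} {X : V}
    (t : ∀ a, X ⊗ (b ⟶[V] F.obj a) ⟶ (c ⟶[V] G.obj a)) :
    IsNatural (homFrom F b) G t ↔ ∀ a a',
      X ◁ ((b ⟶[V] F.obj a) ◁ F.map a a' ≫ eComp V b (F.obj a) (F.obj a')) ≫ t a' =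
        (α_ X (b ⟶[V] F.obj a) (a ⟶[V] a')).inv ≫ (t a ⊗ₘ G.map a a') ≫
          eComp V c (G.obj a) (G.obj a') := by
  refine forall₂_congr fun a a' ↦ ?_
  rw [action_homFrom]
  rfl

lemma CompUniversal.isWeightedLimit (hF : CompUniversal F) (H : EnrichedFunctor V B D) {b : B}
    (μ : Cylinder (homFrom F b) (F.comp V H) (H.obj b))
    (hμ : ∀ a, μ.app a = H.map b (F.obj a)) : μ.IsWeightedLimit := by
  rw [Cylinder.isWeightedLimit_iff]
  intro c X t ht
  simp only [hμ]
  exact hF.existsUnique H t ((isNatural_homFrom_iff t).1 ht)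

/-- The case `H = 1`, treated separately because the diagram is `F` itself, whose action agrees with
that of `1 F` only after removing a composite with an identity. -/
lemma CompUniversal.isWeightedLimit_id (hF : CompUniversal F) {b : B}
    (μ : Cylinder (homFrom F b) F b) (hμ : ∀ a, μ.app a = 𝟙 (b ⟶[V] F.obj a)) :
    μ.IsWeightedLimit := by
  rw [Cylinder.isWeightedLimit_iff]
  intro c X t ht
  simp only [hμ]
  refine hF.existsUnique (EnrichedFunctor.id V B) t fun a a' ↦ ?_
  refine ((isNatural_homFrom_iff t).1 ht a a').trans ?_
  exact congrArg (fun g ↦ _ ≫ (_ ⊗ₘ g) ≫ _) (Category.comp_id _).symm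

lemma CompUniversal.isCodense (hF : CompUniversal F) : IsCodense F := fun _ ↦
  hF.isWeightedLimit_id _ fun _ ↦ (Category.id_comp _).trans (postComp_eId _ _)

/-- The weight `B(F-, b)` is by definition the covariant weight of `Fᵒᵖ` at `op b`, so the limit
statement for `Fᵒᵖ` applies. -/
lemma CompUniversal.isDense (hF : CompUniversal (opFunctor F)) : IsDense F := fun b ↦
  hF.isWeightedLimit_id (b := op b) (lanCylinder (idToComp F) b)
    fun _ ↦ (Category.id_comp _).trans (preComp_eId _ _)

lemma ranCylinder_whiskerFrom_app (H : EnrichedFunctor V B D) (b : B) (a : A) :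
    (ranCylinder (whiskerFrom (idFromComp F) H) b).app a = H.map b (F.obj a) := by
  have h : eId V (F.obj a) ≫ H.map (F.obj a) (F.obj a) = eId V (H.obj (F.obj a)) := H.map_id _
  refine (Category.assoc _ _ _).trans ((Category.id_comp _).trans ?_)
  refine (congrArg (fun e ↦ _ ≫ postComp e _) h).trans ?_
  exact (congrArg (_ ≫ ·) (postComp_eId _ _)).trans (Category.comp_id _)

lemma lanCylinder_whiskerTo_app (H : EnrichedFunctor V B D) (b : B) (a : Aᵒᵖ) :
    (lanCylinder (whiskerTo (idToComp F) H) b).app a = H.map (F.obj a.unop) b := by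
  have h : eId V (F.obj a.unop) ≫ H.map (F.obj a.unop) (F.obj a.unop) =
    eId V (H.obj (F.obj a.unop)) := H.map_id _
  refine (Category.assoc _ _ _).trans ((Category.id_comp _).trans ?_)
  refine (congrArg (fun e ↦ _ ≫ preComp e _) h).trans ?_
  exact (congrArg (_ ≫ ·) (preComp_eId _ _)).trans (Category.comp_id _)

lemma CompUniversal.isPointwiseRan (hF : CompUniversal F) (H : EnrichedFunctor V B D) :
    IsPointwiseRan (whiskerFrom (idFromComp F) H) := fun b ↦
  hF.isWeightedLimit H _ (ranCylinder_whiskerFrom_app H b)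

lemma CompUniversal.isPointwiseLan (hF : CompUniversal (opFunctor F))
    (H : EnrichedFunctor V B D) : IsPointwiseLan (whiskerTo (idToComp F) H) := fun b ↦
  hF.isWeightedLimit (opFunctor H) (b := op b) (lanCylinder (whiskerTo (idToComp F) H) b)
    (lanCylinder_whiskerTo_app H b)

end Forward

/-! ### Absolute (co)density implies universality of composition -/

section Backward

variable {V : Type v} [Category.{w} V] [MonoidalCategory V]

/-- The lift of a `V`-category to a larger universe of objects. -/
instance enrichedCategoryULift {C : Type u₃} [EnrichedCategory V C] :
    EnrichedCategory V (ULift.{t} C) where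
  Hom x y := x.down ⟶[V] y.down
  id x := eId V x.down
  comp x y z := eComp V x.down y.down z.down
  id_comp x y := e_id_comp V x.down y.down
  comp_id x y := e_comp_id V x.down y.down
  assoc w x y z := e_assoc V w.down x.down y.down z.down

/-- The isomorphism of `V`-categories from `C` to its lift to a larger universe of objects. -/
def upFunctor (C : Type u₃) [EnrichedCategory V C] : EnrichedFunctor V C (ULift.{t} C) where
  obj c := ⟨c⟩
  map c d := 𝟙 (c ⟶[V] d)
  map_id c := Category.comp_id (eId V c)
  map_comp x y z := by
    refine (Category.comp_id (eComp V x y z)).trans ?_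
    rw [id_tensorHom_id, Category.id_comp]
    rfl

variable [SymmetricCategory V] [MonoidalClosed V] {A : Type u₁} [EnrichedCategory V A]
  {B : Type u₂} [EnrichedCategory V B]

/-- The contravariant representable `B(-, b')`, as a `V`-functor `B ⟶ Vᵒᵖ`. -/
def coHomFunctor (b' : B) : EnrichedFunctor V B Vᵒᵖ where
  obj b := op (b ⟶[V] b')
  map x y := (homFunctor (V := V) (op b')).map (op y) (op x)
  map_id b := (homFunctor (V := V) (op b')).map_id (op b)
  map_comp x y z := by
    have h := (opFunctor (homFunctor (V := V) (op b'))).map_comp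
      (op (op x)) (op (op y)) (op (op z))
    -- The right-hand side is composition in the double opposite of `B`, the source of `h`.
    have e : eComp V x y z = (β_ _ _).hom ≫ (β_ _ _).hom ≫ eComp V x y z := by
      rw [SymmetricCategory.symmetry_assoc]
    exact (congrArg (· ≫ _) e).trans h

lemma uncurry_tensorHom_braiding_comp {x y z X Y : V} (f : X ⟶ (ihom y).obj z)
    (g : Y ⟶ (ihom x).obj y) :
    MonoidalClosed.uncurry ((f ⊗ₘ g) ≫ (β_ _ _).hom ≫ MonoidalClosed.comp x y z) =
      x ◁ (β_ X Y).hom ≫ (α_ x Y X).inv ≫ MonoidalClosed.uncurry g ▷ X ≫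
        MonoidalClosed.uncurry f := by
  rw [braiding_naturality_assoc, MonoidalClosed.uncurry_natural_left, uncurry_tensorHom_comp]

/-- The hypothesis is the universal property of the limit of `HF` weighted by `B(b, F-)`, for `H =
B(-, b') : B ⟶ Vᵒᵖ`, tested only on elements of shape `𝟙_ V`. Composition in `Vᵒᵖ` accounts for the
braiding before `MonoidalClosed.comp`. -/
lemma compUniversal_of_existsUnique (F : EnrichedFunctor V A B)
    (h : ∀ (b b' : B) (Y : V)
      (t : ∀ a, 𝟙_ V ⊗ (b ⟶[V] F.obj a) ⟶ (ihom (F.obj a ⟶[V] b')).obj Y),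
      (∀ a a', 𝟙_ V ◁ ((b ⟶[V] F.obj a) ◁ F.map a a' ≫ eComp V b (F.obj a) (F.obj a')) ≫ t a' =
        (α_ (𝟙_ V) (b ⟶[V] F.obj a) (a ⟶[V] a')).inv ≫ (t a ⊗ₘ (F.map a a' ≫
          MonoidalClosed.curry ((β_ _ _).hom ≫ eComp V (F.obj a) (F.obj a') b'))) ≫
            (β_ _ _).hom ≫ MonoidalClosed.comp (F.obj a' ⟶[V] b') (F.obj a ⟶[V] b') Y) →
      ∃! f : 𝟙_ V ⟶ (ihom (b ⟶[V] b')).obj Y, ∀ a,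
        (f ⊗ₘ MonoidalClosed.curry ((β_ _ _).hom ≫ eComp V b (F.obj a) b')) ≫
          (β_ _ _).hom ≫ MonoidalClosed.comp (F.obj a ⟶[V] b') (b ⟶[V] b') Y = t a) :
    CompUniversal F := by
  intro b b' Y k hk
  -- A map `g` corresponds to its name `𝟙_ V ⟶ [B(b, b'), Y]`; under this bijection the limit
  -- equation becomes factorization through composition.
  have key : ∀ (a : A) (g : (b ⟶[V] b') ⟶ Y),
      (MonoidalClosed.curry ((ρ_ (b ⟶[V] b')).hom ≫ g) ⊗ₘ
        MonoidalClosed.curry ((β_ _ _).hom ≫ eComp V b (F.obj a) b')) ≫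
          (β_ _ _).hom ≫ MonoidalClosed.comp (F.obj a ⟶[V] b') (b ⟶[V] b') Y =
      (λ_ _).hom ≫ MonoidalClosed.curry ((β_ _ _).hom ≫ k a) ↔
      eComp V b (F.obj a) b' ≫ g = k a := by
    intro a g
    have e : (MonoidalClosed.curry ((ρ_ (b ⟶[V] b')).hom ≫ g) ⊗ₘ
        MonoidalClosed.curry ((β_ _ _).hom ≫ eComp V b (F.obj a) b')) ≫
          (β_ _ _).hom ≫ MonoidalClosed.comp (F.obj a ⟶[V] b') (b ⟶[V] b') Y =
        (λ_ _).hom ≫ MonoidalClosed.curry ((β_ _ _).hom ≫ eComp V b (F.obj a) b' ≫ g) := by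
      apply MonoidalClosed.uncurry_injective
      rw [uncurry_tensorHom_braiding_comp, uncurry_comp_curry]
      simp only [MonoidalClosed.uncurry_curry]
      rw [rightUnitor_naturality_assoc, rightUnitor_tensor_hom, Category.assoc,
        Iso.inv_hom_id_assoc, ← MonoidalCategory.whiskerLeft_comp_assoc, braiding_rightUnitor,
        Category.assoc]
    rw [e, cancel_epi, MonoidalClosed.curry_injective.eq_iff, cancel_epi]
  obtain ⟨f, hf, hu⟩ := h b b' Y
    (fun a ↦ (λ_ _).hom ≫ MonoidalClosed.curry ((β_ _ _).hom ≫ k a)) (fun a a' ↦ by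
      have hk' := (balanced_iff F k).1 hk a a'
      rw [action_homFrom, action_homTo] at hk'
      rw [leftUnitor_naturality_assoc, ← whiskerRight_comp_tensorHom_assoc,
        ← leftUnitor_tensor_hom_assoc, cancel_epi]
      apply MonoidalClosed.uncurry_injective
      rw [uncurry_tensorHom_braiding_comp, uncurry_comp_curry, uncurry_comp_curry,
        MonoidalClosed.uncurry_curry]
      exact hk')
  have hf' : MonoidalClosed.curry ((ρ_ (b ⟶[V] b')).hom ≫ (ρ_ (b ⟶[V] b')).inv ≫
      MonoidalClosed.uncurry f) = f := by
    rw [Iso.hom_inv_id_assoc, MonoidalClosed.curry_uncurry]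
  refine ⟨(ρ_ _).inv ≫ MonoidalClosed.uncurry f, fun a ↦ (key a _).1 ?_, fun g hg ↦ ?_⟩
  · rw [hf']
    exact hf a
  · rw [← hu _ fun a ↦ (key a g).2 (hg a), MonoidalClosed.uncurry_curry, Iso.inv_hom_id_assoc]

/-- Preservation is applied to `B(-, b')`, with target `Vᵒᵖ` lifted by `ULift` so that its objects
lie in the universe `max v t` over which the targets range. -/
lemma AbsolutelyCodense.compUniversal {F : EnrichedFunctor V A B}
    (hF : AbsolutelyCodense.{w, v, u₁, u₂, max v t} F) : CompUniversal F := by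
  refine compUniversal_of_existsUnique F fun b b' Y t ht ↦ ?_
  have hmap : ∀ x y, ((coHomFunctor b').comp V (upFunctor.{w, v, v, t} Vᵒᵖ)).map x y =
      MonoidalClosed.curry ((β_ _ _).hom ≫ eComp V x y b') := fun x y ↦ Category.comp_id _
  obtain ⟨f, hf, hu⟩ := (Cylinder.isWeightedLimit_iff _).1
    (hF.2 (ULift.{t} Vᵒᵖ) ((coHomFunctor b').comp V (upFunctor Vᵒᵖ)) b) ⟨op Y⟩ (𝟙_ V) t
    ((isNatural_homFrom_iff (F := F) _).2 fun a a' ↦ (ht a a').trans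
      (congrArg (fun g ↦ _ ≫ (_ ⊗ₘ (_ ≫ g)) ≫ _) (hmap _ _).symm))
  have happ := fun a ↦ (ranCylinder_whiskerFrom_app (F := F)
    ((coHomFunctor b').comp V (upFunctor.{w, v, v, t} Vᵒᵖ)) b a).trans (hmap _ _)
  exact ⟨f, fun a ↦ (congrArg (fun m ↦ (f ⊗ₘ m) ≫ _) (happ a)).symm.trans (hf a),
    fun g hg ↦ hu g fun a ↦ (congrArg (fun m ↦ (g ⊗ₘ m) ≫ _) (happ a)).trans (hg a)⟩

/-- Preservation is applied to the covariant representable into `V`. Its opposite is the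
contravariant representable of `Bᵒᵖ`, up to the double braiding removed in `hmap`. -/
lemma AbsolutelyDense.compUniversal {F : EnrichedFunctor V A B}
    (hF : AbsolutelyDense.{w, v, u₁, u₂, max v t} F) : CompUniversal (opFunctor F) := by
  refine compUniversal_of_existsUnique (opFunctor F) fun b b' Y t ht ↦ ?_
  have hmap : ∀ x y : Bᵒᵖ,
      ((homFunctor b'.unop).comp V (upFunctor.{w, v, v, t} V)).map y.unop x.unop =
        MonoidalClosed.curry ((β_ _ _).hom ≫ eComp V x y b') := fun x y ↦ by
    refine (Category.comp_id _).trans ?_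
    exact congrArg MonoidalClosed.curry (SymmetricCategory.symmetry_assoc _ _ _).symm
  obtain ⟨f, hf, hu⟩ := (Cylinder.isWeightedLimit_iff _).1
    (hF.2 (ULift.{t} V) ((homFunctor b'.unop).comp V (upFunctor V)) b.unop) (op ⟨Y⟩) (𝟙_ V) t
    ((isNatural_homFrom_iff (F := opFunctor F) _).2 fun a a' ↦ (ht a a').trans
      (congrArg (fun g ↦ _ ≫ (_ ⊗ₘ (_ ≫ g)) ≫ _) (hmap _ _).symm))
  have happ := fun a ↦ (lanCylinder_whiskerTo_app (F := F)
    ((homFunctor b'.unop).comp V (upFunctor.{w, v, v, t} V)) b.unop a).trans (hmap _ _)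
  exact ⟨f, fun a ↦ (congrArg (fun m ↦ (f ⊗ₘ m) ≫ _) (happ a)).symm.trans (hf a),
    fun g hg ↦ hu g fun a ↦ (congrArg (fun m ↦ (g ⊗ₘ m) ≫ _) (happ a)).trans (hg a)⟩

end Backward

end EnrichedDensity

theorem theorem2p10 {V : Type v} [CategoryTheory.Category.{w} V]
    [CategoryTheory.MonoidalCategory V] [CategoryTheory.SymmetricCategory V]
    [CategoryTheory.MonoidalClosed V] [CategoryTheory.Limits.HasLimits V]
    [CategoryTheory.Limits.HasColimits V]
    {A : Type u₁} [CategoryTheory.EnrichedCategory V A]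
    {B : Type u₂} [CategoryTheory.EnrichedCategory V B]
    (F : CategoryTheory.EnrichedFunctor V A B) :
    List.TFAE [
      EnrichedDensity.CauchyDense F,
      EnrichedDensity.AbsolutelyDense.{w, v, u₁, u₂, max v t} F,
      EnrichedDensity.AbsolutelyCodense.{w, v, u₁, u₂, max v t} F] := by
  tfae_have 1 → 2 := fun h ↦
    have h' := (EnrichedDensity.cauchyDense_iff_compUniversal_op F).1 h
    ⟨h'.isDense, fun _ _ H ↦ h'.isPointwiseLan H⟩
  tfae_have 2 → 1 := fun h ↦
    (EnrichedDensity.cauchyDense_iff_compUniversal_op F).2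
      (EnrichedDensity.AbsolutelyDense.compUniversal.{w, v, u₁, u₂, t} h)
  tfae_have 1 → 3 := fun h ↦
    have h' := (EnrichedDensity.cauchyDense_iff_compUniversal F).1 h
    ⟨h'.isCodense, fun _ _ H ↦ h'.isPointwiseRan H⟩
  tfae_have 3 → 1 := fun h ↦
    (EnrichedDensity.cauchyDense_iff_compUniversal F).2
      (EnrichedDensity.AbsolutelyCodense.compUniversal.{w, v, u₁, u₂, t} h)
  tfae_finish
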